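/- Let $R$ be a commutative Noetherian ring, and let $M, N$ be $R$-modules (not necessarily finitely generated). For a complex $X=(\cdots\to X_{i+1}\to X_i\to X_{i-1}\to\cdots)$ of $R$-modules put $\operatorname{hsup}X=\sup\{i\in\mathbb Z\mid \operatorname{H}_i(X)\neq 0\}$ and $\operatorname{hinf}X=\inf\{i\in\mathbb Z\mid \operatorname{H}_i(X)\neq 0\}$, with values in $\mathbb Z\cup\{\pm\infty\}$, where $\sup\varnothing=-\infty$ and $\inf\varnothing=+\infty$; in sums and differences of extended numbers, $(-\infty)+(+\infty)=-\infty$. The complex $\operatorname{Hom}_R(P,N)$ is graded homologically, with $\operatorname{Hom}_R(P_{-i},N)$ in degree $i$. A *finite quasi-projective resolution* of $M$ is a bounded complex $P$ of projective $R$-modules for which there are integers $a_i\ge 0$ $(i\in\mathbb Z)$, not all zero, with $\operatorname{H}_i(P)\cong M^{\oplus a_i}$ for all $i$. Assume that $M$ admits a finite quasi-projective resolution $P$, and set $$l=\sup\{\operatorname{hsup}P-\operatorname{hinf}P,\ \operatorname{hsup}(P\otimes_RN)-\operatorname{hinf}P-1\},$$ $$m=\sup\{\operatorname{hsup}P-\operatorname{hinf}P,\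 -\operatorname{hinf}(\operatorname{Hom}_R(P,N))-\operatorname{hinf}P-1\}.$$ Then for every integer $n\ge 1$ the following hold. 1. If $\operatorname{Tor}^R_i(M,N)=0$ for all $n\le i\le n+l$, then $\operatorname{Tor}^R_i(M,N)=0$ for all $i\ge n$. 2. If $\operatorname{Ext}_R^i(M,N)=0$ for all $n\le i\le n+m$, then $\operatorname{Ext}_R^i(M,N)=0$ for all $i\ge n$. 3. If $\operatorname{Tor}^R_i(M,N)=0$ for all sufficiently large $i$, then $\operatorname{Tor}^R_i(M,N)=0$ for all $i\ge 0$ with $i>\operatorname{hsup}(P\otimes_RN)-\operatorname{hsup}P$. 4. If $\operatorname{Ext}_R^i(M,N)=0$ for all sufficiently large $i$, then $\operatorname{Ext}_R^i(M,N)=0$ for all $i\ge 0$ with $i>-\operatorname{hinf}(\operatorname{Hom}_R(P,N))-\operatorname{hsup}P$. -/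

import Mathlib

open CategoryTheory CategoryTheory.Limits

universe u

noncomputable section

namespace QuasiProjective

variable {R : Type u} [CommRing R]

/-- The homological supremum `sup {i ∈ ℤ | H_i(X) ≠ 0}` of a complex of `R`-modules, an extended
number; it is `-∞` when `X` is exact. -/
def hsup (X : ChainComplex (ModuleCat.{u} R) ℤ) : EReal :=
  ⨆ (i : ℤ) (_ : ¬ IsZero (X.homology i)), ((i : ℝ) : EReal)

/-- The homological infimum `inf {i ∈ ℤ | H_i(X) ≠ 0}` of a complex of `R`-modules, an extended
number; it is `+∞` when `X` is exact. -/
def hinf (X : ChainComplex (ModuleCat.{u} R) ℤ) : EReal :=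
  ⨅ (i : ℤ) (_ : ¬ IsZero (X.homology i)), ((i : ℝ) : EReal)

/-- The complex `P` is a quasi-projective resolution of `M`: a bounded below complex of projective
modules each of whose homology modules is a finite direct sum `M^{⊕ a_i}`, where the
non-negative integers `a_i` are not all zero. (Below the infimum of `P` the homology vanishes,
so that `a_i = 0` there when `M ≠ 0`; when `M = 0`, every bounded below exact complex of
projectives, including the zero complex, is a quasi-projective resolution.) -/
structure IsQuasiProjectiveResolution
    (P : ChainComplex (ModuleCat.{u} R) ℤ) (M : ModuleCat.{u} R) : Prop where
  projective : ∀ i : ℤ, Projective (P.X i)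
  boundedBelow : ∃ b : ℤ, ∀ i : ℤ, i < b → IsZero (P.X i)
  homology_iso : ∃ a : ℤ → ℕ, (∃ i, a i ≠ 0) ∧
    ∀ i : ℤ, Nonempty (P.homology i ≃ₗ[R] (Fin (a i) → M))

/-- A quasi-projective resolution is finite when it is also bounded above. -/
structure IsFiniteQuasiProjectiveResolution
    (P : ChainComplex (ModuleCat.{u} R) ℤ) (M : ModuleCat.{u} R) : Prop
    extends IsQuasiProjectiveResolution P M where
  boundedAbove : ∃ b : ℤ, ∀ i : ℤ, b < i → IsZero (P.X i)

/-- The complex `P ⊗_R N`, with `P_i ⊗_R N` in degree `i`. -/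
def tensorComplex (P : ChainComplex (ModuleCat.{u} R) ℤ) (N : ModuleCat.{u} R) :
    ChainComplex (ModuleCat.{u} R) ℤ :=
  ((MonoidalCategory.tensorRight N).mapHomologicalComplex (ComplexShape.down ℤ)).obj P

/-- The complex `Hom_R(P, N)`, homologically graded: `Hom_R(P_{-i}, N)` in degree `i`, the
differential being composition with the differential of `P`. -/
def homComplex (P : ChainComplex (ModuleCat.{u} R) ℤ) (N : ModuleCat.{u} R) :
    ChainComplex (ModuleCat.{u} R) ℤ where
  X i := ModuleCat.of R (P.X (-i) →ₗ[R] N)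
  d i j := ModuleCat.ofHom (LinearMap.lcomp R N (P.d (-j) (-i)).hom)
  shape i j h := by
    have h' : ¬ (ComplexShape.down ℤ).Rel (-j) (-i) := by
      simp only [ComplexShape.down_Rel] at h ⊢
      omega
    rw [P.shape _ _ h']
    ext f x
    simp
  d_comp_d' i j k _ _ := by
    ext f x
    have h : (P.d (-j) (-i)).hom ((P.d (-k) (-j)).hom x) = 0 := by
      rw [← LinearMap.comp_apply, ← ModuleCat.hom_comp, P.d_comp_d]
      rfl
    simp [h]

/-- `l = sup {hsup P - hinf P, hsup (P ⊗ N) - hinf P - 1}`. -/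
def torBound (P : ChainComplex (ModuleCat.{u} R) ℤ) (N : ModuleCat.{u} R) : EReal :=
  max (hsup P - hinf P) (hsup (tensorComplex P N) - hinf P - 1)

/-- `m = sup {hsup P - hinf P, -hinf Hom(P, N) - hinf P - 1}`. -/
def extBound (P : ChainComplex (ModuleCat.{u} R) ℤ) (N : ModuleCat.{u} R) : EReal :=
  max (hsup P - hinf P) (-hinf (homComplex P N) - hinf P - 1)

end QuasiProjective

end

noncomputable section

namespace QuasiProjective

variable {R : Type u} [CommRing R]

/-! The reason is the hyperhomology spectral sequence Tor_p(H_q(P), N) ⇒ H_{p+q}(P ⊗ N), all of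
whose rows are powers of the one family Tor_p(M, N). Let M ≠ 0, t = hinf P, s = hsup P, w = hsup(P ⊗
N). No differential enters the bottom row q = t, and those leaving (j, t) end in columns from j - (s
- t) - 1 to j - 2. If Tor vanishes there and t + j > w, then Tor_j(M, N) = 0, so a window of
vanishing propagates upwards. No differential leaves the top row q = s, and those entering come from
higher Tor, so vanishing propagates downwards while s + i > w. For Ext, w is -hinf Hom(P, N).
Dimension shifting replaces the spectral sequence. With C_q = P_q / B_q, it uses 0 → B_q → P_q → C_q
→ 0 and 0 → H_{q+1} → C_{q+1} → B_q → 0; `homology_bottom` and `homology_top` treat the two edge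
rows. The limit enters only when q + 1 > w: then Tor_1(C_q, N) = 0, and Tor_1(B_q, N) = 0 implies
H_{q+1}(P) ⊗ N = 0. Only vanishing matters, so `rigidity` serves Tor and Ext alike. -/

/-- The vanishing pattern of a family of half-exact functors `F_i` of modules connected by long
exact sequences: `V i X` stands for `F_i X = 0`. Since only vanishing is recorded, the same axioms
hold for `Tor_i(-, N)` and for `Ext^i(-, N)`. -/
structure IsVanishingPattern (V : ℕ → ModuleCat.{u} R → Prop) : Prop where
  of_isZero : ∀ {i : ℕ} {X : ModuleCat.{u} R}, IsZero X → V i X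
  of_projective : ∀ {i : ℕ} {X : ModuleCat.{u} R}, Projective X → V (i + 1) X
  of_retract : ∀ {i : ℕ} {X Y : ModuleCat.{u} R}, Retract X Y → V i Y → V i X
  middle : ∀ {i : ℕ} {S : ShortComplex (ModuleCat.{u} R)}, S.ShortExact →
    V i S.X₁ → V i S.X₃ → V i S.X₂
  right : ∀ {i : ℕ} {S : ShortComplex (ModuleCat.{u} R)}, S.ShortExact →
    V (i + 1) S.X₂ → V i S.X₁ → V (i + 1) S.X₃
  left : ∀ {i : ℕ} {S : ShortComplex (ModuleCat.{u} R)}, S.ShortExact →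
    V i S.X₂ → V (i + 1) S.X₃ → V i S.X₁

/-! ### Boundaries, cokernels and homology of a complex -/

/-- The image of the differential `P_{q+1} → P_q`. -/
abbrev boundaries (P : ChainComplex (ModuleCat.{u} R) ℤ) (q : ℤ) : ModuleCat.{u} R :=
  ModuleCat.of R (LinearMap.range (P.d (q + 1) q).hom)

/-- The cokernel of the differential `P_{q+1} → P_q`. -/
abbrev coker (P : ChainComplex (ModuleCat.{u} R) ℤ) (q : ℤ) : ModuleCat.{u} R :=
  ModuleCat.of R (P.X q ⧸ LinearMap.range (P.d (q + 1) q).hom)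

lemma d_d_apply (P : ChainComplex (ModuleCat.{u} R) ℤ) (i j k : ℤ) (x : P.X i) :
    (P.d j k).hom ((P.d i j).hom x) = 0 := by
  rw [← LinearMap.comp_apply, ← ModuleCat.hom_comp, P.d_comp_d]
  rfl

/-- The short exact sequence `0 → B_q → P_q → P_q / B_q → 0`. -/
abbrev boundariesSequence (P : ChainComplex (ModuleCat.{u} R) ℤ) (q : ℤ) :
    ShortComplex (ModuleCat.{u} R) :=
  ShortComplex.moduleCatMk (LinearMap.range (P.d (q + 1) q).hom).subtype
    (LinearMap.range (P.d (q + 1) q).hom).mkQ (by ext x; simp)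

lemma boundariesSequence_shortExact (P : ChainComplex (ModuleCat.{u} R) ℤ) (q : ℤ) :
    (boundariesSequence P q).ShortExact := by
  apply ModuleCat.shortComplex_shortExact
  · exact LinearMap.exact_subtype_mkQ _
  · exact Submodule.subtype_injective _
  · exact Submodule.mkQ_surjective _

/-- The map `P_{q+1} / B_{q+1} → B_q` induced by the differential. -/
abbrev cokerToBoundaries (P : ChainComplex (ModuleCat.{u} R) ℤ) (q : ℤ) :
    coker P (q + 1) →ₗ[R] boundaries P q :=
  (LinearMap.range (P.d (q + 1 + 1) (q + 1)).hom).liftQ (P.d (q + 1) q).hom.rangeRestrict (by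
    rintro _ ⟨x, rfl⟩
    exact Subtype.ext (d_d_apply P _ _ _ x))

/-- The short exact sequence `0 → H_{q+1} → P_{q+1} / B_{q+1} → B_q → 0`, whose first term is
realised as the kernel of the second map. -/
abbrev cokerSequence (P : ChainComplex (ModuleCat.{u} R) ℤ) (q : ℤ) :
    ShortComplex (ModuleCat.{u} R) :=
  (cokerToBoundaries P q).shortComplexKer

lemma cokerSequence_shortExact (P : ChainComplex (ModuleCat.{u} R) ℤ) (q : ℤ) :
    (cokerSequence P q).ShortExact := by
  apply LinearMap.shortExact_shortComplexKer
  rintro ⟨_, x, rfl⟩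
  exact ⟨Submodule.Quotient.mk x, rfl⟩

/-- The class of a cycle in `P_{q+1} / B_{q+1}`, as an element of the kernel of the map to `B_q`. -/
def cyclesToKer (P : ChainComplex (ModuleCat.{u} R) ℤ) (q : ℤ) :
    LinearMap.ker (P.d (q + 1) q).hom →ₗ[R] (cokerSequence P q).X₁ :=
  ((LinearMap.range (P.d (q + 1 + 1) (q + 1)).hom).mkQ.comp
    (LinearMap.ker (P.d (q + 1) q).hom).subtype).codRestrict
      (LinearMap.ker (cokerToBoundaries P q)) fun x => Subtype.ext x.2

lemma cyclesToKer_surjective (P : ChainComplex (ModuleCat.{u} R) ℤ) (q : ℤ) :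
    Function.Surjective (cyclesToKer P q) := by
  rintro ⟨y, hy⟩
  obtain ⟨x, rfl⟩ := Submodule.mkQ_surjective _ y
  exact ⟨⟨x, congrArg Subtype.val hy⟩, rfl⟩

lemma cyclesToKer_eq_zero_iff (P : ChainComplex (ModuleCat.{u} R) ℤ) (q : ℤ)
    (x : LinearMap.ker (P.d (q + 1) q).hom) :
    cyclesToKer P q x = 0 ↔ ∃ y, (P.d (q + 1 + 1) (q + 1)).hom y = x :=
  Subtype.ext_iff.trans (Submodule.Quotient.mk_eq_zero _)

/-- The kernel of `P_{q+1} / B_{q+1} → B_q` is the homology of `P`. -/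
def kerIsoHomology (P : ChainComplex (ModuleCat.{u} R) ℤ) (q : ℤ) :
    (cokerSequence P q).X₁ ≅ P.homology (q + 1) := by
  refine ?_ ≪≫ (P.homologyIsoSc' (q + 1 + 1) (q + 1) q (by simp) (by simp) ≪≫
    (P.sc' (q + 1 + 1) (q + 1) q).moduleCatHomologyIso).symm
  refine ((Submodule.quotEquivOfEq _ _ ?_).trans
    ((cyclesToKer P q).quotKerEquivOfSurjective (cyclesToKer_surjective P q))).symm.toModuleIso
  ext x
  refine Iff.trans ?_ (cyclesToKer_eq_zero_iff P q x).symm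
  exact ⟨fun ⟨y, hy⟩ => ⟨y, congrArg Subtype.val hy⟩, fun ⟨y, hy⟩ => ⟨y, Subtype.ext hy⟩⟩

/-! ### Dimension shifting for vanishing patterns -/

namespace IsVanishingPattern

variable {V : ℕ → ModuleCat.{u} R → Prop}

lemma of_iso (hV : IsVanishingPattern V) {i : ℕ} {X Y : ModuleCat.{u} R} (e : X ≅ Y)
    (h : V i Y) : V i X :=
  hV.of_retract ⟨e.hom, e.inv, e.hom_inv_id⟩ h

lemma pow (hV : IsVanishingPattern V) {i : ℕ} {M : ModuleCat.{u} R} (h : V i M) (a : ℕ) :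
    V i (ModuleCat.of R (Fin a → M)) := by
  induction a with
  | zero => exact hV.of_isZero (ModuleCat.isZero_of_subsingleton _)
  | succ a ih =>
    let S : ShortComplex (ModuleCat.{u} R) :=
      ShortComplex.moduleCatMk (LinearMap.single R (fun _ : Fin (a + 1) => M) 0)
        (LinearMap.funLeft R M Fin.succ) (by
          ext x j
          simp [LinearMap.funLeft_apply])
    have hS : S.ShortExact := by
      apply ModuleCat.shortComplex_shortExact
      · intro y
        constructor
        · intro hy
          refine ⟨y 0, funext fun j => ?_⟩
          change (Pi.single 0 (y 0) : Fin (a + 1) → M) j = y j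
          refine Fin.cases ?_ (fun k => ?_) j
          · simp
          · exact (Pi.single_eq_of_ne (Fin.succ_ne_zero k) _).trans (congrFun hy k).symm
        · rintro ⟨x, rfl⟩
          exact S.moduleCat_zero_apply x
      · exact LinearMap.ker_eq_bot.1 (LinearMap.ker_single R (fun _ : Fin (a + 1) => M) 0)
      · exact LinearMap.funLeft_surjective_of_injective R M _ (Fin.succ_injective a)
    exact hV.middle hS h ih

/-- A nonzero finite power of `M` has the same vanishing as `M`. -/
lemma of_pow (hV : IsVanishingPattern V) {i : ℕ} {M : ModuleCat.{u} R} {a : ℕ} (ha : a ≠ 0)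
    (h : V i (ModuleCat.of R (Fin a → M))) : V i M := by
  obtain ⟨a, rfl⟩ := Nat.exists_eq_succ_of_ne_zero ha
  refine hV.of_retract (Y := ModuleCat.of R (Fin (a + 1) → M))
    ⟨ModuleCat.ofHom (LinearMap.single R (fun _ : Fin (a + 1) => M) 0),
      ModuleCat.ofHom (LinearMap.proj 0), ?_⟩ h
  ext x
  simp

variable (P : ChainComplex (ModuleCat.{u} R) ℤ)

lemma homology_of_homology_iso (hV : IsVanishingPattern V) {i : ℕ} {X M : ModuleCat.{u} R}
    {a : ℕ} (e : X ≃ₗ[R] (Fin a → M)) (h : V i M) : V i X :=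
  hV.of_iso (Y := ModuleCat.of R (Fin a → M)) e.toModuleIso (hV.pow h a)

lemma of_homology_iso (hV : IsVanishingPattern V) {i : ℕ} {X M : ModuleCat.{u} R}
    {a : ℕ} (e : X ≃ₗ[R] (Fin a → M)) (hX : ¬ IsZero X) (h : V i X) : V i M := by
  refine hV.of_pow (a := a) ?_ (hV.of_iso (X := ModuleCat.of R (Fin a → M)) e.symm.toModuleIso h)
  rintro rfl
  have := e.toEquiv.subsingleton
  exact hX (ModuleCat.isZero_of_subsingleton X)

lemma coker_succ (hV : IsVanishingPattern V) {i : ℕ} {q : ℤ} (hH : V i (P.homology (q + 1)))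
    (hB : V i (boundaries P q)) : V i (coker P (q + 1)) :=
  hV.middle (cokerSequence_shortExact P q) (hV.of_iso (kerIsoHomology P q) hH) hB

lemma boundaries_of_coker_succ (hV : IsVanishingPattern V) {i : ℕ} {q : ℤ}
    (hC : V (i + 1) (coker P (q + 1))) (hH : V i (P.homology (q + 1))) :
    V (i + 1) (boundaries P q) :=
  hV.right (cokerSequence_shortExact P q) hC (hV.of_iso (kerIsoHomology P q) hH)

lemma homology_succ (hV : IsVanishingPattern V) {i : ℕ} {q : ℤ}
    (hC : V i (coker P (q + 1))) (hB : V (i + 1) (boundaries P q)) :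
    V i (P.homology (q + 1)) :=
  hV.of_iso (kerIsoHomology P q).symm (hV.left (cokerSequence_shortExact P q) hC hB)

variable (hP : ∀ i, Projective (P.X i))
include hP

/-- The shift starts in degree one because `V 0` may fail for P_q. -/
lemma coker_iff_boundaries (hV : IsVanishingPattern V) {i : ℕ} {q : ℤ} :
    V (i + 2) (coker P q) ↔ V (i + 1) (boundaries P q) :=
  ⟨hV.left (boundariesSequence_shortExact P q) (hV.of_projective (hP q)),
    hV.right (boundariesSequence_shortExact P q) (hV.of_projective (hP q))⟩

/-- If `V` holds in all degrees `> i` for the homology in degrees `≤ s`, then it also does for the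
cokernels of the differentials in degrees `≤ s`. -/
lemma coker_of_homology (hV : IsVanishingPattern V) {b : ℤ} (hb : ∀ j < b, IsZero (P.X j))
    {i : ℕ} {s : ℤ} (hH : ∀ q ≤ s, ∀ j, i < j → V j (P.homology q)) :
    ∀ q ≤ s, ∀ j, i < j → V j (coker P q) := by
  -- Induction upwards from b, below which the cokernels are zero.
  have key : ∀ k : ℕ, ∀ q ≤ s, q < b + k → ∀ j, i < j → V j (coker P q) := by
    intro k
    induction k with
    | zero =>
      intro q _ hq j _
      have := ModuleCat.subsingleton_of_isZero (hb q (by simpa using hq))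
      exact hV.of_isZero (ModuleCat.isZero_of_subsingleton _)
    | succ k ih =>
      intro q hqs hq j hj
      obtain ⟨q, rfl⟩ : ∃ r, q = r + 1 := ⟨q - 1, by ring⟩
      refine hV.coker_succ P (hH _ hqs j hj) ?_
      obtain ⟨j, rfl⟩ := Nat.exists_eq_succ_of_ne_zero (Nat.ne_zero_of_lt hj)
      -- Passing from B to C raises the degree by one, so the claim has to cover all j > i at once.
      exact (hV.coker_iff_boundaries P hP).1
        (ih q (by omega) (by push_cast at hq; omega) (j + 2) (by omega))
  intro q hq j hj
  exact key (q - b + 1).toNat q hq (by omega) j hj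

/-- Dimension shifting along the cokernels of the differentials. -/
lemma coker_of_coker_add (hV : IsVanishingPattern V) (r : ℕ) {i : ℕ} {q : ℤ}
    (hC : V (i + 1) (coker P (q + r)))
    (hH : ∀ k : ℕ, k < r → V (i + r - 1 - k) (P.homology (q + k + 1))) :
    V (i + r + 1) (coker P q) := by
  induction r generalizing q with
  | zero => simpa using hC
  | succ r ih =>
    have h : V (i + r + 1) (coker P (q + 1)) := by
      refine ih ?_ fun k hk => ?_
      · convert hC using 2
        push_cast; ring
      · convert hH (k + 1) (by omega) using 1
        · omega
        · congr 1; push_cast; ring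
    have h0 : V (i + r) (P.homology (q + 1)) := by simpa using hH 0 (by omega)
    -- B_q is the quotient of C_{q+1} by H_{q+1}, which costs one vanishing of the homology in
    -- degree i + r.
    exact (hV.coker_iff_boundaries P hP).2 (hV.boundaries_of_coker_succ P h h0)

end IsVanishingPattern

/-! ### The bottom and top rows -/

namespace IsVanishingPattern

variable {V : ℕ → ModuleCat.{u} R → Prop} (P : ChainComplex (ModuleCat.{u} R) ℤ)
  (hP : ∀ i, Projective (P.X i))
include hP

/-- Vanishing for the lowest homology module: the class in the lowest row of the hyperhomology
spectral sequence survives to the limit, here replaced by dimension shifting. -/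
lemma homology_bottom (hV : IsVanishingPattern V) {b : ℤ} (hb : ∀ j < b, IsZero (P.X j))
    {t : ℤ} (ht : ∀ q < t, IsZero (P.homology q)) {j : ℕ}
    (hC : V 1 (coker P (t + j)))
    (hH : ∀ k : ℕ, k < j → V (j - 1 - k) (P.homology (t + k + 1))) :
    V (j + 1) (P.homology t) := by
  have h1 : V (0 + j + 1) (coker P t) :=
    hV.coker_of_coker_add P hP j hC fun k hk => by simpa using hH k hk
  rw [zero_add] at h1
  obtain ⟨t, rfl⟩ : ∃ r, t = r + 1 := ⟨t - 1, by ring⟩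
  refine hV.homology_succ P h1 ((hV.coker_iff_boundaries P hP).1 ?_)
  -- There is no homology below the bottom row, so the cokernels there satisfy `V` in all positive
  -- degrees: no differential enters.
  exact hV.coker_of_homology P hP hb (i := 0)
    (fun q hq j _ => hV.of_isZero (ht q (by omega))) t le_rfl _ (by omega)

/-- Vanishing for the highest homology module: the class in the highest row of the hyperhomology
spectral sequence survives to the limit, here replaced by dimension shifting. -/
lemma homology_top (hV : IsVanishingPattern V) {b : ℤ} (hb : ∀ j < b, IsZero (P.X j))
    {s : ℤ} (hs : ∀ q, s < q → IsZero (P.homology q)) {i : ℕ}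
    (hH : ∀ q ≤ s, ∀ j, i < j → V j (P.homology q))
    (hC : ∀ j, i = j + 1 → V 1 (coker P (s + j)))
    (h0 : i = 0 → V 1 (boundaries P (s - 1)) → V 0 (P.homology s)) :
    V i (P.homology s) := by
  obtain ⟨s, rfl⟩ : ∃ r, s = r + 1 := ⟨s - 1, by ring⟩
  have hB : V (i + 1) (boundaries P s) :=
    (hV.coker_iff_boundaries P hP).1
      (hV.coker_of_homology P hP hb hH s (by omega) _ (by omega))
  cases i with
  -- In degree 0 the axioms give no hold on C_s, as projectives need not satisfy `V 0`; `h0`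
  -- supplies the direct argument.
  | zero => exact h0 rfl (by rwa [add_sub_cancel_right])
  | succ j =>
    have h1 : V (0 + j + 1) (coker P (s + 1)) :=
      hV.coker_of_coker_add P hP j (hC j rfl) fun k hk => hV.of_isZero (hs _ (by omega))
    rw [zero_add] at h1
    exact hV.homology_succ P h1 hB

end IsVanishingPattern

/-! ### Extremal degrees of homology -/

/-- A complex with bounded, nonzero homology attains its homological supremum. -/
lemma exists_hsup_eq {P : ChainComplex (ModuleCat.{u} R) ℤ} {b : ℤ}
    (hb : ∀ i, b < i → IsZero (P.X i)) {i₀ : ℤ} (h₀ : ¬ IsZero (P.homology i₀)) :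
    ∃ s : ℤ, hsup P = ((s : ℝ) : EReal) ∧ ¬ IsZero (P.homology s) ∧
      ∀ q, s < q → IsZero (P.homology q) := by
  have hb' : ∀ i, ¬ IsZero (P.homology i) → i ≤ b := fun i hi => by
    by_contra! h
    exact hi (HomologicalComplex.ExactAt.of_isZero (hb i h)).isZero_homology
  obtain ⟨s, hs, hmax⟩ := Int.exists_greatest_of_bdd ⟨b, hb'⟩ ⟨i₀, h₀⟩
  refine ⟨s, le_antisymm (iSup₂_le fun i hi => ?_)
    (le_iSup₂ (f := fun (i : ℤ) (_ : ¬ IsZero (P.homology i)) => ((i : ℝ) : EReal)) s hs), hs,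
    fun q hq => ?_⟩
  · exact_mod_cast hmax i hi
  · by_contra h
    exact absurd (hmax q h) (by omega)

/-- A complex with bounded, nonzero homology attains its homological infimum. -/
lemma exists_hinf_eq {P : ChainComplex (ModuleCat.{u} R) ℤ} {b : ℤ}
    (hb : ∀ i, i < b → IsZero (P.X i)) {i₀ : ℤ} (h₀ : ¬ IsZero (P.homology i₀)) :
    ∃ t : ℤ, hinf P = ((t : ℝ) : EReal) ∧ ¬ IsZero (P.homology t) ∧
      ∀ q, q < t → IsZero (P.homology q) := by
  have hb' : ∀ i, ¬ IsZero (P.homology i) → b ≤ i := fun i hi => by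
    by_contra! h
    exact hi (HomologicalComplex.ExactAt.of_isZero (hb i h)).isZero_homology
  obtain ⟨t, ht, hmin⟩ := Int.exists_least_of_bdd ⟨b, hb'⟩ ⟨i₀, h₀⟩
  refine ⟨t, le_antisymm
    (iInf₂_le (f := fun (i : ℤ) (_ : ¬ IsZero (P.homology i)) => ((i : ℝ) : EReal)) t ht)
    (le_iInf₂ fun i hi => ?_), ht, fun q hq => ?_⟩
  · exact_mod_cast hmin i hi
  · by_contra h
    exact absurd (hmin q h) (by omega)

lemma isZero_homology_of_hsup_lt {P : ChainComplex (ModuleCat.{u} R) ℤ} {q : ℤ}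
    (h : hsup P < ((q : ℝ) : EReal)) : IsZero (P.homology q) := by
  by_contra hq
  exact absurd h (not_lt.2
    (le_iSup₂ (f := fun (i : ℤ) (_ : ¬ IsZero (P.homology i)) => ((i : ℝ) : EReal)) q hq))

lemma isZero_homology_of_lt_hinf {P : ChainComplex (ModuleCat.{u} R) ℤ} {q : ℤ}
    (h : ((q : ℝ) : EReal) < hinf P) : IsZero (P.homology q) := by
  by_contra hq
  exact absurd h (not_lt.2
    (iInf₂_le (f := fun (i : ℤ) (_ : ¬ IsZero (P.homology i)) => ((i : ℝ) : EReal)) q hq))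

/-! ### Rigidity for vanishing patterns -/

/-- Rigidity of a vanishing pattern along a finite quasi-projective resolution. The extended number
`w` bounds the degrees in which the complex computing the total derived functor has homology. -/
theorem rigidity {V : ℕ → ModuleCat.{u} R → Prop} (hV : IsVanishingPattern V)
    {P : ChainComplex (ModuleCat.{u} R) ℤ} {M : ModuleCat.{u} R}
    (hP : IsFiniteQuasiProjectiveResolution P M) (w : EReal)
    (hw₁ : ∀ q : ℤ, w < (((q + 1 : ℤ) : ℝ) : EReal) → V 1 (coker P q))
    (hw₀ : ∀ q : ℤ, w < (((q + 1 : ℤ) : ℝ) : EReal) → V 1 (boundaries P q) →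
      V 0 (P.homology (q + 1))) :
    (∀ n : ℕ, 1 ≤ n → (∀ i : ℕ, n ≤ i →
        (i : EReal) ≤ (n : EReal) + max (hsup P - hinf P) (w - hinf P - 1) → V i M) →
      ∀ i : ℕ, n ≤ i → V i M) ∧
    ((∃ k : ℕ, ∀ i : ℕ, k ≤ i → V i M) → ∀ i : ℕ, w - hsup P < (i : EReal) → V i M) := by
  -- For M = 0 the complex is exact, and `hsup P`, `hinf P` are not integers.
  by_cases hM : IsZero M
  · exact ⟨fun _ _ _ _ _ => hV.of_isZero hM, fun _ _ _ => hV.of_isZero hM⟩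
  obtain ⟨b, hb⟩ := hP.boundedBelow
  obtain ⟨c, hc⟩ := hP.boundedAbove
  obtain ⟨a, ⟨i₀, hi₀⟩, e⟩ := hP.homology_iso
  have h₀ : ¬ IsZero (P.homology i₀) := fun h => by
    have := ModuleCat.subsingleton_of_isZero h
    have : Subsingleton (Fin (a i₀) → M) := (e i₀).some.symm.toEquiv.subsingleton
    have : NeZero (a i₀) := ⟨hi₀⟩
    have : Subsingleton M := ⟨fun x y =>
      congrFun (Subsingleton.elim (fun _ : Fin (a i₀) => x) fun _ => y) 0⟩
    exact hM (ModuleCat.isZero_of_subsingleton M)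
  obtain ⟨s, hs, hs', hs_top⟩ := exists_hsup_eq hc h₀
  obtain ⟨t, ht, ht', ht_bot⟩ := exists_hinf_eq hb h₀
  have toH : ∀ i q, V i M → V i (P.homology q) := fun i q h =>
    hV.homology_of_homology_iso (e q).some h
  constructor
  · intro n hn h j
    induction j using Nat.strong_induction_on with
    | _ j ih =>
    intro hj
    by_cases hle : (j : EReal) ≤ (n : EReal) + max (hsup P - hinf P) (w - hinf P - 1)
    · exact h j hj hle
    rw [hs, ht, not_le] at hle
    have h1 : n + (s - t) < (j : ℤ) := by
      have : (n : EReal) + ((s : ℝ) - (t : ℝ)) < j :=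
        lt_of_le_of_lt (add_le_add_right (le_max_left _ _) _) hle
      exact_mod_cast this
    -- Here n ≥ 1 absorbs the -1 in the bound. For w = ⊤ the window is infinite and no j lies beyond
    -- it.
    have h2 : w < (((t + j : ℤ) : ℝ) : EReal) := by
      have : (n : EReal) + (w - (t : ℝ) - 1) < j :=
        lt_of_le_of_lt (add_le_add_right (le_max_right _ _) _) hle
      induction w with
      | bot => exact EReal.bot_lt_coe _
      | top =>
        rw [← EReal.coe_one, EReal.top_sub_coe, EReal.top_sub_coe, ← EReal.coe_natCast,
          EReal.coe_add_top] at this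
        exact absurd this not_top_lt
      | coe w =>
        have h' : (n : ℝ) + (w - (t : ℝ) - 1) < j := by exact_mod_cast this
        have : (1 : ℝ) ≤ n := by exact_mod_cast hn
        rw [EReal.coe_lt_coe_iff]
        push_cast
        linarith
    obtain ⟨j, rfl⟩ := Nat.exists_eq_succ_of_ne_zero (by omega : j ≠ 0)
    refine hV.of_homology_iso (e t).some ht' (hV.homology_bottom P hP.projective hb ht_bot ?_ ?_)
    · apply hw₁
      rwa [show t + (j : ℤ) + 1 = t + (j.succ : ℤ) by push_cast; ring]
    · intro k hk
      -- A row above s is zero; in the others `h1` keeps the degree at least n, within reach of the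
      -- induction.
      by_cases hks : s < t + k + 1
      · exact hV.of_isZero (hs_top _ hks)
      · exact toH _ _ (ih _ (by omega) (by omega))
  · rintro ⟨k, hk⟩
    -- Descending induction on the degree: d bounds how far i lies below k.
    suffices H : ∀ d i : ℕ, k ≤ i + d → w - hsup P < (i : EReal) → V i M from
      fun i hi => H k i (by omega) hi
    intro d
    induction d with
    | zero => exact fun i hi _ => hk i hi
    | succ d ih =>
    intro i hi hwi
    have hlt : w < (((s + i : ℤ) : ℝ) : EReal) := by
      rw [hs] at hwi
      induction w with
      | bot => exact EReal.bot_lt_coe _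
      | top => simp at hwi
      | coe w =>
        have h' : w - (s : ℝ) < i := by exact_mod_cast hwi
        rw [EReal.coe_lt_coe_iff]
        push_cast
        linarith
    refine hV.of_homology_iso (e s).some hs' (hV.homology_top P hP.projective hb hs_top ?_ ?_ ?_)
    · intro q _ j hj
      refine toH _ _ (ih j (by omega) (hwi.trans_le ?_))
      exact_mod_cast hj.le
    · rintro j rfl
      apply hw₁
      rwa [show s + (j : ℤ) + 1 = s + ((j + 1 : ℕ) : ℤ) by push_cast; ring]
    · rintro rfl hB
      have := hw₀ (s - 1) (by simpa using hlt) hB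
      rwa [sub_add_cancel] at this

/-! ### Ext as a vanishing pattern -/

open Abelian in
lemma isVanishingPattern_ext (N : ModuleCat.{u} R) :
    IsVanishingPattern (fun i X => Subsingleton (Ext.{u} X N i)) where
  of_isZero {i X} hX := by
    refine subsingleton_of_forall_eq 0 fun x => ?_
    rw [← Ext.mk₀_id_comp x, hX.eq_of_src (𝟙 X) 0, Ext.mk₀_zero, Ext.zero_comp]
  of_projective hX := subsingleton_of_forall_eq 0 Ext.eq_zero_of_projective
  of_retract {i X Y} r h := by
    refine subsingleton_of_forall_eq 0 fun x => ?_
    rw [← Ext.mk₀_id_comp x, ← r.retract, ← Ext.mk₀_comp_mk₀_assoc,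
      Subsingleton.elim ((Ext.mk₀ r.r).comp x (zero_add i)) 0, Ext.comp_zero]
  middle {i S} hS h₁ h₃ := by
    refine subsingleton_of_forall_eq 0 fun x => ?_
    obtain ⟨y, rfl⟩ := Ext.contravariant_sequence_exact₂ hS N x (Subsingleton.elim _ _)
    rw [Subsingleton.elim y 0, Ext.comp_zero]
  right {i S} hS h₂ h₁ := by
    refine subsingleton_of_forall_eq 0 fun x => ?_
    obtain ⟨y, rfl⟩ := Ext.contravariant_sequence_exact₃ hS N x (Subsingleton.elim _ _)
      (add_comm 1 i)
    rw [Subsingleton.elim y 0, Ext.comp_zero]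
  left {i S} hS h₂ h₃ := by
    refine subsingleton_of_forall_eq 0 fun x => ?_
    obtain ⟨y, rfl⟩ := Ext.contravariant_sequence_exact₁ hS N x (add_comm 1 i)
      (Subsingleton.elim _ _)
    rw [Subsingleton.elim y 0, Ext.comp_zero]

open Abelian in
/-- The first `Ext` of a quotient of a projective vanishes when every map from the kernel
extends. -/
lemma subsingleton_ext_one {S : ShortComplex (ModuleCat.{u} R)} (hS : S.ShortExact)
    (hP : Projective S.X₂) {N : ModuleCat.{u} R} (h : ∀ f : S.X₁ ⟶ N, ∃ g, S.f ≫ g = f) :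
    Subsingleton (Ext.{u} S.X₃ N 1) := by
  refine subsingleton_of_forall_eq 0 fun x => ?_
  obtain ⟨y, rfl⟩ := Ext.contravariant_sequence_exact₃ hS N x (Ext.eq_zero_of_projective _)
    (add_zero 1)
  obtain ⟨f, rfl⟩ := Ext.addEquiv₀.symm.surjective y
  obtain ⟨g, rfl⟩ := h f
  simp [← Ext.mk₀_comp_mk₀]

open Abelian in
/-- If the first `Ext` of the cokernel vanishes, then every map from the kernel extends. -/
lemma exists_extension {S : ShortComplex (ModuleCat.{u} R)} (hS : S.ShortExact)
    {N : ModuleCat.{u} R} (h : Subsingleton (Ext.{u} S.X₃ N 1)) (f : S.X₁ ⟶ N) :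
    ∃ g, S.f ≫ g = f := by
  obtain ⟨y, hy⟩ := Ext.contravariant_sequence_exact₁ hS N (Ext.mk₀ f) (add_zero 1)
    (Subsingleton.elim _ _)
  obtain ⟨g, rfl⟩ := Ext.addEquiv₀.symm.surjective y
  refine ⟨g, Ext.addEquiv₀.symm.injective ?_⟩
  simpa using hy

/-- Exactness of `Hom(P, N)` in terms of cocycles and coboundaries. -/
lemma exists_of_isZero_homology_homComplex {P : ChainComplex (ModuleCat.{u} R) ℤ}
    {N : ModuleCat.{u} R} {a b c : ℤ} (hab : b + 1 = a) (hbc : c + 1 = b)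
    (h : IsZero ((homComplex P N).homology (-b))) (f : P.X b →ₗ[R] N)
    (hf : f ∘ₗ (P.d a b).hom = 0) : ∃ g : P.X c →ₗ[R] N, g ∘ₗ (P.d b c).hom = f := by
  obtain ⟨i, rfl⟩ : ∃ i, b = -i := ⟨-b, by ring⟩
  obtain ⟨k, rfl⟩ : ∃ k, a = -k := ⟨-a, by ring⟩
  obtain ⟨j, rfl⟩ : ∃ j, c = -j := ⟨-c, by ring⟩
  rw [neg_neg, ← HomologicalComplex.exactAt_iff_isZero_homology,
    HomologicalComplex.exactAt_iff' _ j i k (by simp; omega) (by simp; omega),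
    ShortComplex.moduleCat_exact_iff] at h
  exact h f hf

/-- Composing B_q → N with P_{q+1} → B_q gives a cocycle of Hom(P, N), hence a coboundary; a
primitive P_q → N is the required extension. -/
lemma subsingleton_ext_one_coker {P : ChainComplex (ModuleCat.{u} R) ℤ}
    (hP : ∀ i, Projective (P.X i)) {N : ModuleCat.{u} R} {q : ℤ}
    (h : IsZero ((homComplex P N).homology (-(q + 1)))) :
    Subsingleton (Abelian.Ext.{u} (coker P q) N 1) := by
  refine subsingleton_ext_one (boundariesSequence_shortExact P q) (hP q) fun f => ?_
  obtain ⟨g, hg⟩ := exists_of_isZero_homology_homComplex rfl rfl h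
    (f.hom ∘ₗ (P.d (q + 1) q).hom.rangeRestrict) (by
      ext x
      exact (congrArg f.hom (Subtype.ext (d_d_apply P _ _ _ x))).trans (map_zero f.hom))
  refine ⟨ModuleCat.ofHom g, ?_⟩
  ext ⟨_, x, rfl⟩
  exact LinearMap.congr_fun hg x

/-- A map H_{q+1} → N extends to C_{q+1} because Ext^1(B_q, N) = 0. Pulled back to P_{q+1} it is a
cocycle, so it factors through the differential and kills cycles. -/
lemma subsingleton_ext_zero_homology {P : ChainComplex (ModuleCat.{u} R) ℤ}
    {N : ModuleCat.{u} R} {q : ℤ} (h : IsZero ((homComplex P N).homology (-(q + 1))))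
    (hB : Subsingleton (Abelian.Ext.{u} (boundaries P q) N 1)) :
    Subsingleton (Abelian.Ext.{u} (P.homology (q + 1)) N 0) := by
  refine (isVanishingPattern_ext N).of_iso (kerIsoHomology P q).symm ?_
  refine Abelian.Ext.addEquiv₀.subsingleton_congr.2 (subsingleton_of_forall_eq 0 fun f => ?_)
  obtain ⟨f', rfl⟩ := exists_extension (cokerSequence_shortExact P q) hB f
  obtain ⟨g, hg⟩ := exists_of_isZero_homology_homComplex rfl rfl h
    (f'.hom ∘ₗ (LinearMap.range (P.d (q + 1 + 1) (q + 1)).hom).mkQ) (by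
      ext x
      have : (LinearMap.range (P.d (q + 1 + 1) (q + 1)).hom).mkQ
          ((P.d (q + 1 + 1) (q + 1)).hom x) = 0 := by simp
      rw [LinearMap.comp_apply, LinearMap.comp_apply, this, map_zero, LinearMap.zero_apply])
  ext x
  obtain ⟨z, rfl⟩ := cyclesToKer_surjective P q x
  refine (LinearMap.congr_fun hg z.1).symm.trans ?_
  have hz : (P.d (q + 1) q).hom z.1 = 0 := z.2
  simp [hz]

theorem ext_rigidity {P : ChainComplex (ModuleCat.{u} R) ℤ} {M : ModuleCat.{u} R}
    (N : ModuleCat.{u} R) (hP : IsFiniteQuasiProjectiveResolution P M) :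
    (∀ n : ℕ, 1 ≤ n → (∀ i : ℕ, n ≤ i → (i : EReal) ≤ (n : EReal) + extBound P N →
        Subsingleton (Abelian.Ext.{u} M N i)) →
      ∀ i : ℕ, n ≤ i → Subsingleton (Abelian.Ext.{u} M N i)) ∧
    ((∃ k : ℕ, ∀ i : ℕ, k ≤ i → Subsingleton (Abelian.Ext.{u} M N i)) →
      ∀ i : ℕ, -hinf (homComplex P N) - hsup P < (i : EReal) →
        Subsingleton (Abelian.Ext.{u} M N i)) := by
  have hz : ∀ q : ℤ, -hinf (homComplex P N) < (((q + 1 : ℤ) : ℝ) : EReal) →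
      IsZero ((homComplex P N).homology (-(q + 1))) := fun q hq =>
    isZero_homology_of_lt_hinf (by
      rw [Int.cast_neg, EReal.coe_neg]
      exact EReal.neg_lt_comm.1 hq)
  exact rigidity (isVanishingPattern_ext N) hP _
    (fun q hq => subsingleton_ext_one_coker hP.projective (hz q hq))
    (fun q hq => subsingleton_ext_zero_homology (hz q hq))

/-! ### Tor as a vanishing pattern -/

open MonoidalCategory

/-- The complex `X ⊗ Q_•`, for `Q_•` a chosen projective resolution of `N`. -/
abbrev torComplex (X N : ModuleCat.{u} R) : ChainComplex (ModuleCat.{u} R) ℕ :=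
  (((tensoringLeft (ModuleCat.{u} R)).obj X).mapHomologicalComplex (ComplexShape.down ℕ)).obj
    (projectiveResolution N).complex

/-- The map of complexes `X ⊗ Q_• → Y ⊗ Q_•` induced by `f : X ⟶ Y`. -/
abbrev torComplexMap {X Y : ModuleCat.{u} R} (f : X ⟶ Y) (N : ModuleCat.{u} R) :
    torComplex X N ⟶ torComplex Y N :=
  (NatTrans.mapHomologicalComplex ((tensoringLeft (ModuleCat.{u} R)).map f)
    (ComplexShape.down ℕ)).app (projectiveResolution N).complex

/-- `Tor` is computed by `torComplex`. -/
def torIso (X N : ModuleCat.{u} R) (i : ℕ) :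
    ((Tor (ModuleCat.{u} R) i).obj X).obj N ≅ (torComplex X N).homology i :=
  (projectiveResolution N).isoLeftDerivedObj ((tensoringLeft (ModuleCat.{u} R)).obj X) i

/-- The degree zero homology of `torComplex` is the tensor product. -/
def torComplexZeroIso (X N : ModuleCat.{u} R) : (torComplex X N).homology 0 ≅ X ⊗ N :=
  haveI : PreservesFiniteColimits ((tensoringLeft (ModuleCat.{u} R)).obj X) :=
    inferInstanceAs (PreservesFiniteColimits (tensorLeft X))
  ChainComplex.isoHomologyι₀ _ ≪≫ asIso ((projectiveResolution N).fromLeftDerivedZero'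
    ((tensoringLeft (ModuleCat.{u} R)).obj X))

lemma torComplexZeroIso_naturality {X Y : ModuleCat.{u} R} (f : X ⟶ Y) (N : ModuleCat.{u} R) :
    HomologicalComplex.homologyMap (torComplexMap f N) 0 ≫ (torComplexZeroIso Y N).hom =
      (torComplexZeroIso X N).hom ≫ f ▷ N := by
  have key : HomologicalComplex.opcyclesMap (torComplexMap f N) 0 ≫
      (projectiveResolution N).fromLeftDerivedZero' ((tensoringLeft (ModuleCat.{u} R)).obj Y) =
      (projectiveResolution N).fromLeftDerivedZero' ((tensoringLeft (ModuleCat.{u} R)).obj X) ≫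
        f ▷ N := by
    rw [← cancel_epi (HomologicalComplex.pOpcycles _ _), HomologicalComplex.p_opcyclesMap_assoc,
      ProjectiveResolution.pOpcycles_comp_fromLeftDerivedZero',
      ProjectiveResolution.pOpcycles_comp_fromLeftDerivedZero'_assoc]
    exact (((tensoringLeft (ModuleCat.{u} R)).map f).naturality _).symm
  simp only [torComplexZeroIso, Iso.trans_hom, asIso_hom, Category.assoc, ← key]
  exact HomologicalComplex.homologyι_naturality_assoc _ _ _

/-- Moves injectivity from the long exact sequence to tensor products, where elements can be chased.
-/
lemma mono_homologyMap_zero_iff {X Y : ModuleCat.{u} R} (f : X ⟶ Y) (N : ModuleCat.{u} R) :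
    Mono (HomologicalComplex.homologyMap (torComplexMap f N) 0) ↔ Mono (f ▷ N) := by
  have h := torComplexZeroIso_naturality f N
  constructor
  · intro _
    rw [← Iso.inv_comp_eq] at h
    rw [← h]
    infer_instance
  · intro _
    rw [← Iso.eq_comp_inv, Category.assoc] at h
    rw [h]
    infer_instance

lemma flat_of_projective {X : ModuleCat.{u} R} (hX : Projective X) : Module.Flat R X := by
  have : Module.Projective R X := (IsProjective.iff_projective X).2 hX
  infer_instance

/-- The short exact sequence `0 → X₁ ⊗ Q_• → X₂ ⊗ Q_• → X₃ ⊗ Q_• → 0`. -/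
abbrev torSequence (S : ShortComplex (ModuleCat.{u} R)) (N : ModuleCat.{u} R) :
    ShortComplex (ChainComplex (ModuleCat.{u} R) ℕ) :=
  ShortComplex.mk (torComplexMap S.f N) (torComplexMap S.g N) (by
    ext1 i
    exact (comp_whiskerRight _ _ _).symm.trans (by rw [S.zero]; exact MonoidalPreadditive.zero_whiskerRight))

/-- Each Q_i is flat. Since N is the module resolved, the resulting long exact sequence is that of
Tor in its first variable. -/
lemma torSequence_shortExact {S : ShortComplex (ModuleCat.{u} R)} (hS : S.ShortExact)
    (N : ModuleCat.{u} R) : (torSequence S N).ShortExact := by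
  refine HomologicalComplex.shortExact_of_degreewise_shortExact _ fun i => ?_
  have hQ := flat_of_projective ((projectiveResolution N).projective i)
  apply ModuleCat.shortComplex_shortExact
  · exact Module.Flat.rTensor_exact (M := (projectiveResolution N).complex.X i)
      ((ShortComplex.ShortExact.moduleCat_exact_iff_function_exact S).1 hS.exact)
  · exact Module.Flat.rTensor_preserves_injective_linearMap
      (M := (projectiveResolution N).complex.X i) S.f.hom hS.moduleCat_injective_f
  · exact LinearMap.rTensor_surjective ((projectiveResolution N).complex.X i)
      (g := S.g.hom) hS.moduleCat_surjective_g

/-- Tensoring with a flat module preserves exactness of complexes. -/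
lemma exactAt_tensor_of_flat (X : ModuleCat.{u} R) [Module.Flat R X]
    {K : ChainComplex (ModuleCat.{u} R) ℕ} {i : ℕ} (h : K.ExactAt i) :
    ((((tensoringLeft (ModuleCat.{u} R)).obj X).mapHomologicalComplex
      (ComplexShape.down ℕ)).obj K).ExactAt i :=
  Module.Flat.lTensor_shortComplex_exact X (K.sc i) h

lemma isZero_homology_torComplex_succ {X : ModuleCat.{u} R} (hX : Projective X)
    (N : ModuleCat.{u} R) (i : ℕ) : IsZero ((torComplex X N).homology (i + 1)) := by
  have := flat_of_projective hX
  exact (exactAt_tensor_of_flat X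
    ((projectiveResolution N).complex_exactAt_succ i)).isZero_homology

lemma isVanishingPattern_tor (N : ModuleCat.{u} R) :
    IsVanishingPattern
      (fun i X => IsZero (((Tor (ModuleCat.{u} R) i).obj X).obj N)) where
  of_isZero {i X} hX := by
    rw [(torIso X N i).isZero_iff]
    refine HomologicalComplex.ExactAt.isZero_homology (HomologicalComplex.ExactAt.of_isZero ?_)
    exact (tensorRight ((projectiveResolution N).complex.X i)).map_isZero hX
  of_projective {i X} hX := (torIso X N _).isZero_iff.2 (isZero_homology_torComplex_succ hX N i)
  of_retract {i X Y} r h := by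
    let r' := r.map ((Tor (ModuleCat.{u} R) i).flip.obj N)
    refine (IsZero.iff_id_eq_zero _).2 (r'.retract.symm.trans ?_)
    rw [IsZero.eq_zero_of_tgt h r'.i]
    exact zero_comp
  middle {i S} hS h₁ h₃ := by
    rw [(torIso _ N i).isZero_iff] at *
    exact ((torSequence_shortExact hS N).homology_exact₂ i).isZero_of_both_isZero h₁ h₃
  right {i S} hS h₂ h₁ := by
    rw [(torIso _ N _).isZero_iff] at *
    exact ((torSequence_shortExact hS N).homology_exact₃ (i + 1) i rfl).isZero_of_both_isZero h₂ h₁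
  left {i S} hS h₂ h₃ := by
    rw [(torIso _ N _).isZero_iff] at *
    exact ((torSequence_shortExact hS N).homology_exact₁ (i + 1) i rfl).isZero_of_both_isZero h₃ h₂

/-- The first `Tor` of a quotient of a projective vanishes when tensoring preserves the injectivity
of the inclusion of the kernel. -/
lemma isZero_tor_one {S : ShortComplex (ModuleCat.{u} R)} (hS : S.ShortExact)
    (hP : Projective S.X₂) {N : ModuleCat.{u} R}
    (h : Function.Injective (S.f.hom.rTensor N)) :
    IsZero (((Tor (ModuleCat.{u} R) 1).obj S.X₃).obj N) := by
  rw [(torIso _ N _).isZero_iff]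
  have hT := torSequence_shortExact hS N
  have : Mono (S.f ▷ N) := (ModuleCat.mono_iff_injective _).2 h
  have := (mono_homologyMap_zero_iff S.f N).2 this
  refine (hT.homology_exact₃ 1 0 rfl).isZero_of_both_zeros
    ((isZero_homology_torComplex_succ hP N 0).eq_zero_of_src _) ?_
  -- The connecting map becomes zero after an injection, so it is zero.
  exact (cancel_mono (HomologicalComplex.homologyMap (torSequence S N).f 0)).1
    ((hT.δ_comp 1 0 rfl).trans zero_comp.symm)

/-- If the first `Tor` of the cokernel vanishes, then tensoring preserves the injectivity of the
inclusion of the kernel. -/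
lemma rTensor_injective_of_isZero_tor_one {S : ShortComplex (ModuleCat.{u} R)}
    (hS : S.ShortExact) {N : ModuleCat.{u} R}
    (h : IsZero (((Tor (ModuleCat.{u} R) 1).obj S.X₃).obj N)) :
    Function.Injective (S.f.hom.rTensor N) := by
  rw [(torIso _ N _).isZero_iff] at h
  have := ((torSequence_shortExact hS N).homology_exact₁ 1 0 rfl).mono_g (h.eq_zero_of_src _)
  exact (ModuleCat.mono_iff_injective _).1 ((mono_homologyMap_zero_iff S.f N).1 this)

/-- Exactness of `P ⊗ N` in terms of cycles and boundaries. -/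
lemma exists_of_isZero_homology_tensorComplex {P : ChainComplex (ModuleCat.{u} R) ℤ}
    {N : ModuleCat.{u} R} {q : ℤ} (h : IsZero ((tensorComplex P N).homology (q + 1)))
    (x : TensorProduct R (P.X (q + 1)) N) (hx : (P.d (q + 1) q).hom.rTensor N x = 0) :
    ∃ y, (P.d (q + 1 + 1) (q + 1)).hom.rTensor N y = x := by
  rw [← HomologicalComplex.exactAt_iff_isZero_homology,
    HomologicalComplex.exactAt_iff' _ (q + 1 + 1) (q + 1) q (by simp) (by simp),
    ShortComplex.moduleCat_exact_iff] at h
  exact h x hx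

/-- An element of B_q ⊗ N killed in P_q ⊗ N lifts to a cycle in P_{q+1} ⊗ N. It is a boundary, and
boundaries die in B_q ⊗ N. -/
lemma isZero_tor_one_coker {P : ChainComplex (ModuleCat.{u} R) ℤ}
    (hP : ∀ i, Projective (P.X i)) {N : ModuleCat.{u} R} {q : ℤ}
    (h : IsZero ((tensorComplex P N).homology (q + 1))) :
    IsZero (((Tor (ModuleCat.{u} R) 1).obj (coker P q)).obj N) := by
  refine isZero_tor_one (boundariesSequence_shortExact P q) (hP q) ?_
  rw [injective_iff_map_eq_zero]
  intro x hx
  obtain ⟨y, rfl⟩ := LinearMap.rTensor_surjective N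
    (P.d (q + 1) q).hom.surjective_rangeRestrict x
  obtain ⟨z, rfl⟩ := exists_of_isZero_homology_tensorComplex h y
    ((LinearMap.rTensor_comp_apply N (boundariesSequence P q).f.hom
      (P.d (q + 1) q).hom.rangeRestrict y).trans hx)
  have h0 : (P.d (q + 1) q).hom.rangeRestrict ∘ₗ (P.d (q + 1 + 1) (q + 1)).hom = 0 :=
    LinearMap.ext fun x => Subtype.ext (d_d_apply P _ _ _ x)
  refine (LinearMap.rTensor_comp_apply N _ _ z).symm.trans ?_
  rw [h0, LinearMap.rTensor_zero]
  rfl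

/-- As Tor_1(B_q, N) = 0, H_{q+1} ⊗ N embeds in C_{q+1} ⊗ N. Its elements come from cycles of P ⊗ N,
which are boundaries and so vanish in C_{q+1} ⊗ N. -/
lemma isZero_tor_zero_homology {P : ChainComplex (ModuleCat.{u} R) ℤ}
    {N : ModuleCat.{u} R} {q : ℤ} (h : IsZero ((tensorComplex P N).homology (q + 1)))
    (hB : IsZero (((Tor (ModuleCat.{u} R) 1).obj (boundaries P q)).obj N)) :
    IsZero (((Tor (ModuleCat.{u} R) 0).obj (P.homology (q + 1))).obj N) := by
  refine (isVanishingPattern_tor N).of_iso (kerIsoHomology P q).symm ?_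
  refine ((torIso _ N 0) ≪≫ torComplexZeroIso _ N).isZero_iff.2 ?_
  have hinj := rTensor_injective_of_isZero_tor_one (cokerSequence_shortExact P q) hB
  suffices Subsingleton (TensorProduct R (cokerSequence P q).X₁ N) from
    ModuleCat.isZero_of_subsingleton
      (ModuleCat.of R (TensorProduct R (cokerSequence P q).X₁ N))
  refine subsingleton_of_forall_eq 0 fun x => hinj ?_
  obtain ⟨z, rfl⟩ := LinearMap.rTensor_surjective N (cyclesToKer_surjective P q) x
  obtain ⟨y, hy⟩ := exists_of_isZero_homology_tensorComplex h
    ((LinearMap.ker (P.d (q + 1) q).hom).subtype.rTensor N z) (by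
      have h0 : (P.d (q + 1) q).hom ∘ₗ (LinearMap.ker (P.d (q + 1) q).hom).subtype = 0 :=
        LinearMap.ext fun x => x.2
      rw [← LinearMap.comp_apply, ← LinearMap.rTensor_comp, h0, LinearMap.rTensor_zero,
        LinearMap.zero_apply])
  have h1 : (cokerSequence P q).f.hom ∘ₗ cyclesToKer P q =
      (LinearMap.range (P.d (q + 1 + 1) (q + 1)).hom).mkQ ∘ₗ
        (LinearMap.ker (P.d (q + 1) q).hom).subtype := rfl
  rw [map_zero, ← LinearMap.comp_apply, ← LinearMap.rTensor_comp, h1, LinearMap.rTensor_comp,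
    LinearMap.comp_apply, ← hy, ← LinearMap.comp_apply, ← LinearMap.rTensor_comp,
    LinearMap.range_mkQ_comp, LinearMap.rTensor_zero, LinearMap.zero_apply]

theorem tor_rigidity {P : ChainComplex (ModuleCat.{u} R) ℤ} {M : ModuleCat.{u} R}
    (N : ModuleCat.{u} R) (hP : IsFiniteQuasiProjectiveResolution P M) :
    (∀ n : ℕ, 1 ≤ n → (∀ i : ℕ, n ≤ i → (i : EReal) ≤ (n : EReal) + torBound P N →
        IsZero (((Tor (ModuleCat.{u} R) i).obj M).obj N)) →
      ∀ i : ℕ, n ≤ i → IsZero (((Tor (ModuleCat.{u} R) i).obj M).obj N)) ∧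
    ((∃ k : ℕ, ∀ i : ℕ, k ≤ i → IsZero (((Tor (ModuleCat.{u} R) i).obj M).obj N)) →
      ∀ i : ℕ, hsup (tensorComplex P N) - hsup P < (i : EReal) →
        IsZero (((Tor (ModuleCat.{u} R) i).obj M).obj N)) :=
  rigidity (isVanishingPattern_tor N) hP _
    (fun _ hq => isZero_tor_one_coker hP.projective (isZero_homology_of_hsup_lt hq))
    (fun _ hq => isZero_tor_zero_homology (isZero_homology_of_hsup_lt hq))

end QuasiProjective

end

theorem theorem6p2 {R : Type u} [CommRing R] [IsNoetherianRing R] (M N : ModuleCat.{u} R)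
    (P : ChainComplex (ModuleCat.{u} R) ℤ)
    (hP : QuasiProjective.IsFiniteQuasiProjectiveResolution P M) (n : ℕ) (hn : 1 ≤ n) :
    ((∀ i : ℕ, n ≤ i → (i : EReal) ≤ (n : EReal) + QuasiProjective.torBound P N →
          IsZero (((Tor (ModuleCat.{u} R) i).obj M).obj N)) →
        ∀ i : ℕ, n ≤ i → IsZero (((Tor (ModuleCat.{u} R) i).obj M).obj N)) ∧
    ((∀ i : ℕ, n ≤ i → (i : EReal) ≤ (n : EReal) + QuasiProjective.extBound P N →
          Subsingleton (Abelian.Ext.{u} M N i)) →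
        ∀ i : ℕ, n ≤ i → Subsingleton (Abelian.Ext.{u} M N i)) ∧
    ((∃ k : ℕ, ∀ i : ℕ, k ≤ i → IsZero (((Tor (ModuleCat.{u} R) i).obj M).obj N)) →
        ∀ i : ℕ, QuasiProjective.hsup (QuasiProjective.tensorComplex P N) -
            QuasiProjective.hsup P < (i : EReal) →
          IsZero (((Tor (ModuleCat.{u} R) i).obj M).obj N)) ∧
    ((∃ k : ℕ, ∀ i : ℕ, k ≤ i → Subsingleton (Abelian.Ext.{u} M N i)) →
        ∀ i : ℕ, -QuasiProjective.hinf (QuasiProjective.homComplex P N) -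
            QuasiProjective.hsup P < (i : EReal) →
          Subsingleton (Abelian.Ext.{u} M N i)) := by
  obtain ⟨h₁, h₃⟩ := QuasiProjective.tor_rigidity N hP
  obtain ⟨h₂, h₄⟩ := QuasiProjective.ext_rigidity N hP
  exact ⟨h₁ n hn, h₂ n hn, h₃, h₄⟩
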